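/- Let $(X,\mathcal B,\mu)$ be a probability space (for example a standard probability space). A finite partition of $X$ is a finite collection $\alpha$ of pairwise disjoint measurable sets (its atoms) that cover $X$ up to a $\mu$-null set. A partition $\alpha$ is finer than $\beta$ if each atom of $\beta$ is, modulo $\mu$, a union of atoms of $\alpha$, and two partitions are identified if each is finer than the other. For $r\ge 2$ let $\mathfrak P_r$ be the collection of all partitions with at most $r$ atoms. Put $$H_\mu(\alpha)=-\sum_{A\in\alpha}\mu(A)\log\mu(A),\qquad H_\mu(\alpha|\beta)=-\sum_{B\in\beta}\mu(B)\sum_{A\in\alpha}\mu(A|B)\log\mu(A|B),$$ where $0\log 0=0$, $\mu(A|B)=\mu(A\cap B)/\mu(B)$, and $\mu(A|B)=0$ if $\mu(B)=0$. The Rokhlin metric is $\rho(\alpha,\beta)=H_\mu(\alpha|\beta)+H_\mu(\beta|\alpha)$. Let $K\subset\mathfrak P_r$, and fix for every element of $K$ an arbitrary representative with at most $r$ atoms. Then the following assertions are equivalent: 1. $K$ is precompact in $(\mathfrak P_r,\rho)$, that is, for every $\varepsilon>0$ it has a finite $\varepsilon$-net in $\mathfrak P_r$; 2. the maximal pattern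 entropy $h^*_\mu(K)=\limsup_{n\to\infty}\frac1n\sup_{\alpha_1,\dots,\alpha_n\in K}H_\mu\bigl(\bigvee_{i=1}^n\alpha_i\bigr)$ is zero, where the atoms of $\bigvee_{i=1}^n\alpha_i$ are the sets $\bigcap_{i=1}^nA_i$ with $A_i\in\alpha_i$, and $\sup\emptyset=0$; 3. the set $\{\mathbf 1_A\colon A\in\alpha\in K\}$ is precompact (totally bounded) in $L^2(\mu)$; 4. $K$ has bounded mean complexity: for every $\varepsilon>0$ there is $C\in\mathbb N$ such that every finite nonempty subset $E$ of $K$ satisfies $\mathcal C(E,\varepsilon)\le C$. Here $$\mathcal C(E,\varepsilon)=\min\Bigl\{|D|\colon D\subset X \text{ finite},\ \mu\Bigl(\bigcup_{x\in D}\{y\in X\colon H_E(x,y)<\varepsilon\}\Bigr)>1-\varepsilon\Bigr\},$$ and the normalized Hamming distance is $H_E(x,y)=\frac1{|E|}\,|\{\alpha\in E\colon x\text{ and }y\text{ lie in different atoms of }\alpha\}|$, where the null set of points in no atom of $\alpha$ counts as one further atom. In assertions 3 and 4 the atoms are those of the fixed representatives; the equivalence holds for every choice of them. -/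

import Mathlib

open MeasureTheory Filter
open scoped ENNReal

namespace LowComplexity

/-- A finite measurable partition of `X` modulo `μ`: a finite collection of pairwise disjoint
measurable sets (the atoms, possibly null or empty) which cover `μ`-almost every point. -/
structure FinPart {X : Type*} [MeasurableSpace X] (μ : Measure X) where
  atoms : Finset (Set X)
  measurableSet : ∀ A ∈ atoms, MeasurableSet A
  disjoint : ∀ A ∈ atoms, ∀ B ∈ atoms, A ≠ B → Disjoint A B
  cover : ∀ᵐ x ∂μ, ∃ A ∈ atoms, x ∈ A

namespace FinPart

variable {X : Type*} [MeasurableSpace X] {μ : Measure X}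

/-- `α` is finer than `β`: each atom of `β` is, modulo `μ`, a union of atoms of `α`. -/
def Finer (α β : FinPart μ) : Prop :=
  ∀ B ∈ β.atoms, ∃ S : Finset (Set X), S ⊆ α.atoms ∧ B =ᵐ[μ] (⋃ A ∈ S, A : Set X)

theorem Finer.refl (α : FinPart μ) : α.Finer α := fun B hB =>
  ⟨{B}, by simpa using hB, by simpa using ae_eq_refl B⟩

theorem Finer.trans {α β γ : FinPart μ} (h₁ : α.Finer β) (h₂ : β.Finer γ) : α.Finer γ := by
  classical
  intro C hC
  obtain ⟨S, hS, hCS⟩ := h₂ C hC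
  choose! T hT hBT using h₁
  refine ⟨S.biUnion T, ?_, ?_⟩
  · intro A hA
    obtain ⟨B, hB, hA⟩ := Finset.mem_biUnion.1 hA
    exact hT B (hS hB) hA
  · refine hCS.trans ?_
    have h : (⋃ A ∈ S.biUnion T, A : Set X) = ⋃ B ∈ S, ⋃ A ∈ T B, A := by
      ext x; simp only [Finset.mem_biUnion, Set.mem_iUnion]; grind
    rw [h]
    exact Filter.EventuallyEq.countable_bUnion S.countable_toSet (fun B hB => hBT B (hS hB))

/-- Two partitions are equivalent when each is a refinement of the other. -/
instance setoid (μ : Measure X) : Setoid (FinPart μ) where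
  r α β := α.Finer β ∧ β.Finer α
  iseqv := ⟨fun α => ⟨Finer.refl α, Finer.refl α⟩, fun h => ⟨h.2, h.1⟩,
    fun h k => ⟨h.1.trans k.1, k.2.trans h.2⟩⟩

/-- The entropy `H_μ(α)`; `Real.negMulLog t = -t * log t`, with value `0` at `0`. -/
noncomputable def entropy (α : FinPart μ) : ℝ :=
  ∑ A ∈ α.atoms, Real.negMulLog (μ.real A)

/-- The conditional entropy `H_μ(α | β)`; the quotient is `μ(A | B)`, which is `0` if `μ(B) = 0`. -/
noncomputable def condEntropy (α β : FinPart μ) : ℝ :=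
  ∑ B ∈ β.atoms, μ.real B * ∑ A ∈ α.atoms, Real.negMulLog (μ.real (A ∩ B) / μ.real B)

/-- The join of a finite family of partitions: its atoms are the intersections `⋂ i, A i` of
atoms `A i` of `α i`. -/
noncomputable def iJoin {ι : Type*} [Fintype ι] [DecidableEq ι] (α : ι → FinPart μ) :
    FinPart μ where
  atoms := by
    classical
    exact (Fintype.piFinset fun i => (α i).atoms).image fun f => ⋂ i, f i
  measurableSet := by
    intro A hA
    simp only [Finset.mem_image, Fintype.mem_piFinset] at hA
    obtain ⟨f, hf, rfl⟩ := hA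
    exact MeasurableSet.iInter fun i => (α i).measurableSet _ (hf i)
  disjoint := by
    intro A hA B hB hAB
    simp only [Finset.mem_image, Fintype.mem_piFinset] at hA hB
    obtain ⟨f, hf, rfl⟩ := hA
    obtain ⟨g, hg, rfl⟩ := hB
    have : ∃ i, f i ≠ g i := by
      by_contra! h
      exact hAB (by simp [h])
    obtain ⟨i, hi⟩ := this
    exact ((α i).disjoint _ (hf i) _ (hg i) hi).mono (Set.iInter_subset _ i)
      (Set.iInter_subset _ i)
  cover := by
    have h : ∀ᵐ x ∂μ, ∀ i, ∃ A ∈ (α i).atoms, x ∈ A := ae_all_iff.2 fun i => (α i).cover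
    filter_upwards [h] with x hx
    choose f hf hxf using hx
    refine ⟨⋂ i, f i, ?_, Set.mem_iInter.2 hxf⟩
    simp only [Finset.mem_image, Fintype.mem_piFinset]
    exact ⟨f, hf, rfl⟩

theorem exists_ae_eq {α β : FinPart μ} (h : α ≈ β) {A : Set X} (hA : A ∈ α.atoms)
    (h0 : μ A ≠ 0) : ∃ B ∈ β.atoms, A =ᵐ[μ] B := by
  obtain ⟨S, hS, hAS⟩ := h.2 A hA
  have : ∃ B ∈ S, μ B ≠ 0 := by
    by_contra! hc
    apply h0
    rw [measure_congr hAS]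
    exact (measure_biUnion_null_iff S.countable_toSet).2 hc
  obtain ⟨B, hB, hB0⟩ := this
  have hBA : B ≤ᵐ[μ] A :=
    (Set.subset_biUnion_of_mem (u := fun C : Set X => C) hB).eventuallyLE.trans hAS.symm.le
  obtain ⟨T, hT, hBT⟩ := h.1 B (hS hB)
  have : ∃ C ∈ T, μ C ≠ 0 := by
    by_contra! hc
    apply hB0
    rw [measure_congr hBT]
    exact (measure_biUnion_null_iff T.countable_toSet).2 hc
  obtain ⟨C, hC, hC0⟩ := this
  have hCB : C ≤ᵐ[μ] B :=
    (Set.subset_biUnion_of_mem (u := fun C : Set X => C) hC).eventuallyLE.trans hBT.symm.le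
  have hCA : C = A := by
    by_contra hne
    apply hC0
    have hd := α.disjoint C (hT hC) A hA hne
    rw [measure_eq_zero_iff_ae_notMem]
    filter_upwards [hCB.trans hBA] with x hx hxC
    exact Set.disjoint_left.1 hd hxC (hx hxC)
  subst hCA
  exact ⟨B, hS hB, hCB.antisymm hBA⟩

/-- A sum over atoms depends only on the equivalence class of the partition. -/
theorem sum_congr {α β : FinPart μ} (h : α ≈ β) (φ : Set X → ℝ)
    (h₁ : ∀ A B : Set X, A =ᵐ[μ] B → φ A = φ B) (h₀ : ∀ A : Set X, μ A = 0 → φ A = 0) :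
    ∑ A ∈ α.atoms, φ A = ∑ B ∈ β.atoms, φ B := by
  classical
  have key : ∀ {α β : FinPart μ}, α ≈ β → ∀ A ∈ α.atoms,
      ∑ B ∈ β.atoms, (if A =ᵐ[μ] B then φ A else 0) = φ A := by
    intro α β h A hA
    by_cases hA0 : μ A = 0
    · simp [h₀ A hA0]
    obtain ⟨B, hB, hAB⟩ := exists_ae_eq h hA hA0
    rw [Finset.sum_eq_single_of_mem B hB, if_pos hAB]
    intro C hC hCB
    refine if_neg fun hAC => hA0 ?_
    have hd := β.disjoint C hC B hB hCB
    rw [measure_eq_zero_iff_ae_notMem]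
    filter_upwards [hAB.mem_iff, hAC.mem_iff] with x hx hx' hxA
    exact Set.disjoint_left.1 hd (hx'.1 hxA) (hx.1 hxA)
  rw [← Finset.sum_congr rfl (key h), ← Finset.sum_congr rfl (key (Setoid.symm h)),
    Finset.sum_comm]
  refine Finset.sum_congr rfl fun B _ => Finset.sum_congr rfl fun A _ => ?_
  by_cases hAB : A =ᵐ[μ] B
  · rw [if_pos hAB, if_pos hAB.symm, h₁ A B hAB]
  · rw [if_neg hAB, if_neg fun h => hAB h.symm]

theorem entropy_congr {α β : FinPart μ} (h : α ≈ β) : α.entropy = β.entropy :=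
  sum_congr h _ (fun A B hAB => by rw [measureReal_congr hAB])
    (fun A hA => by simp [measureReal_def, hA])

theorem condEntropy_congr {α α' β β' : FinPart μ} (h : α ≈ α') (k : β ≈ β') :
    α.condEntropy β = α'.condEntropy β' := by
  have h1 : α.condEntropy β = α'.condEntropy β := by
    refine Finset.sum_congr rfl fun B _ => ?_
    rw [sum_congr h (fun A => Real.negMulLog (μ.real (A ∩ B) / μ.real B))]
    · intro A A' hA
      rw [measureReal_congr (hA.inter (ae_eq_refl B))]
    · intro A hA
      have : μ (A ∩ B) = 0 := measure_mono_null Set.inter_subset_left hA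
      simp [measureReal_def, this]
  rw [h1]
  refine sum_congr k
    (fun B => μ.real B * ∑ A ∈ α'.atoms, Real.negMulLog (μ.real (A ∩ B) / μ.real B)) ?_ ?_
  · intro B B' hB
    rw [measureReal_congr hB]
    congr 1
    refine Finset.sum_congr rfl fun A _ => ?_
    rw [measureReal_congr ((ae_eq_refl A).inter hB)]
  · intro B hB
    simp [measureReal_def, hB]

theorem iJoin_finer {ι : Type*} [Fintype ι] [DecidableEq ι] {α β : ι → FinPart μ}
    (h : ∀ i, (α i).Finer (β i)) : (iJoin α).Finer (iJoin β) := by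
  classical
  intro C hC
  simp only [iJoin, Finset.mem_image, Fintype.mem_piFinset] at hC
  obtain ⟨g, hg, rfl⟩ := hC
  choose S hS hgS using fun i => h i (g i) (hg i)
  refine ⟨(Fintype.piFinset S).image fun f => ⋂ i, f i, ?_, ?_⟩
  · exact Finset.image_subset_image (Fintype.piFinset_subset _ _ hS)
  · refine (Filter.EventuallyEq.countable_iInter hgS).trans (Eq.eventuallyEq (Set.ext fun x => ?_))
    simp only [Set.mem_iInter, Set.mem_iUnion, Finset.mem_image, Fintype.mem_piFinset,
      exists_prop]
    constructor
    · intro hx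
      choose f hf hxf using hx
      exact ⟨_, ⟨f, hf, rfl⟩, Set.mem_iInter.2 hxf⟩
    · rintro ⟨_, ⟨f, hf, rfl⟩, hx⟩ i
      exact ⟨f i, hf i, Set.mem_iInter.1 hx i⟩

theorem iJoin_congr {ι : Type*} [Fintype ι] [DecidableEq ι] {α β : ι → FinPart μ}
    (h : ∀ i, α i ≈ β i) : iJoin α ≈ iJoin β :=
  ⟨iJoin_finer fun i => (h i).1, iJoin_finer fun i => (h i).2⟩

end FinPart

/-- The collection `𝔓` of all finite measurable partitions, equivalent ones being identified. -/
def Partitions {X : Type*} [MeasurableSpace X] (μ : Measure X) : Type _ :=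
  Quotient (FinPart.setoid μ)

namespace Partitions

variable {X : Type*} [MeasurableSpace X] {μ : Measure X}

/-- The equivalence class of a partition. -/
def mk (α : FinPart μ) : Partitions μ := Quotient.mk _ α

/-- The collection `𝔓_r` of the partitions with at most `r` atoms. -/
def atMost (μ : Measure X) (r : ℕ) : Set (Partitions μ) :=
  {a | ∃ α : FinPart μ, mk α = a ∧ α.atoms.card ≤ r}

/-- The entropy of an element of `𝔓`. -/
noncomputable def entropy (a : Partitions μ) : ℝ :=
  Quotient.lift FinPart.entropy (fun _ _ h => FinPart.entropy_congr h) a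

/-- The conditional entropy `H_μ(a | b)` on `𝔓`. -/
noncomputable def condEntropy (a b : Partitions μ) : ℝ :=
  Quotient.lift₂ FinPart.condEntropy (fun _ _ _ _ h k => FinPart.condEntropy_congr h k) a b

/-- The Rokhlin metric `ρ(a, b) = H_μ(a | b) + H_μ(b | a)`. -/
noncomputable def rokhlin (a b : Partitions μ) : ℝ :=
  condEntropy a b + condEntropy b a

/-- The join `⋁ i, a i` of a finite family in `𝔓`; see `iJoin_mk`. -/
noncomputable def iJoin {ι : Type*} [Fintype ι] [DecidableEq ι] (a : ι → Partitions μ) :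
    Partitions μ :=
  mk (FinPart.iJoin fun i => Quotient.out (a i))

theorem iJoin_mk {ι : Type*} [Fintype ι] [DecidableEq ι] (α : ι → FinPart μ) :
    iJoin (fun i => mk (α i)) = mk (FinPart.iJoin α) :=
  Quotient.sound (FinPart.iJoin_congr fun i => Quotient.mk_out (α i))

/-- `K` is precompact (totally bounded) in the Rokhlin metric on `𝔓_r`: for every `ε > 0` it has
a finite `ε`-net. -/
def RokhlinPrecompact (r : ℕ) (K : Set (Partitions μ)) : Prop :=
  ∀ ε : ℝ, 0 < ε → ∃ F : Set (Partitions μ), F.Finite ∧ F ⊆ atMost μ r ∧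
    ∀ a ∈ K, ∃ b ∈ F, rokhlin a b < ε

/-- `P*_{K,μ}(n)`, the supremum of `H_μ(a₁ ∨ ⋯ ∨ aₙ)` over all `a₁, …, aₙ ∈ K`
(the entropies are nonnegative when `μ` is a probability measure). -/
noncomputable def patternEntropy (K : Set (Partitions μ)) (n : ℕ) : ℝ≥0∞ :=
  ⨆ a : Fin n → K, ENNReal.ofReal (entropy (iJoin fun i => (a i : Partitions μ)))

/-- The maximal pattern entropy `h*_μ(K) = limsup_n P*_{K,μ}(n) / n`. -/
noncomputable def maxPatternEntropy (K : Set (Partitions μ)) : ℝ≥0∞ :=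
  limsup (fun n : ℕ => patternEntropy K n / (n : ℝ≥0∞)) atTop

/-- `rep` chooses, for every member of `K`, a representative with at most `r` atoms. -/
def IsRepresentation (r : ℕ) (K : Set (Partitions μ)) (rep : Partitions μ → FinPart μ) : Prop :=
  ∀ a ∈ K, mk (rep a) = a ∧ (rep a).atoms.card ≤ r

/-- The set `{𝟏_A : A ∈ a ∈ K}` in `L²(μ)`, the atoms being those of the representatives. -/
def atomIndicators [IsFiniteMeasure μ] (rep : Partitions μ → FinPart μ)
    (K : Set (Partitions μ)) : Set (Lp ℝ 2 μ) :=
  {f | ∃ a ∈ K, ∃ (A : Set X) (hA : A ∈ (rep a).atoms),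
    f = indicatorConstLp 2 ((rep a).measurableSet A hA) (measure_ne_top μ A) (1 : ℝ)}

open Classical in
/-- The normalized Hamming distance `H_E(x, y)`: the proportion of the `a ∈ E` for which the names
of `x` and `y` differ, that is, `x` and `y` do not lie in the same atom of `rep a`. (The null set
of points in no atom is treated as one further atom.) -/
noncomputable def hamming (rep : Partitions μ → FinPart μ) (E : Finset (Partitions μ))
    (x y : X) : ℝ :=
  ((E.filter fun a => ¬ ∀ A ∈ (rep a).atoms, (x ∈ A ↔ y ∈ A)).card : ℝ) / (E.card : ℝ)

/-- The open ball `B_{H_E}(x, ε)`. -/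
def hammingBall (rep : Partitions μ → FinPart μ) (E : Finset (Partitions μ))
    (x : X) (ε : ℝ) : Set X :=
  {y | hamming rep E x y < ε}

/-- `𝒞(E, ε)`: the least cardinality of a finite set `D` of points such that the union of the balls
`B_{H_E}(x, ε)`, `x ∈ D`, has measure greater than `1 - ε`. -/
noncomputable def hammingComplexity (rep : Partitions μ → FinPart μ)
    (E : Finset (Partitions μ)) (ε : ℝ) : ℕ∞ :=
  ⨅ (D : Finset X) (_ : 1 - ε < μ.real (⋃ x ∈ D, hammingBall rep E x ε)), (D.card : ℕ∞)

/-- `K` has bounded mean complexity: for every `ε > 0`, `𝒞(E, ε)` is bounded by a constant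
independent of the finite nonempty subset `E` of `K`. -/
def BoundedMeanComplexity (rep : Partitions μ → FinPart μ) (K : Set (Partitions μ)) : Prop :=
  ∀ ε : ℝ, 0 < ε → ∃ C : ℕ, ∀ E : Finset (Partitions μ), E.Nonempty → (E : Set (Partitions μ)) ⊆ K →
    hammingComplexity rep E ε ≤ (C : ℕ∞)

end Partitions

end LowComplexity

/-! All four assertions are compared with one property, `UniformlyApproximable`: for every η a
single finite partition β has unions of atoms within η of every atom of every member of `K`.

Entropy enters through the mean conditional variance of the indicator of A given β, the sum of μ(B)
p (1 - p) with p = μ(A | B). It is at most μ(A ∆ S) for every union S of atoms of β, at least half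
of this for the best S, and at most H(α | β) if A is an atom of α (`meanVariance_le`,
`exists_measureReal_symmDiff_le`, `meanVariance_le_condEntropy`). Conversely, if all atoms of α are
η-close to unions of atoms of β and α has at most r atoms, then H(α | β) ≤ 2r√η, up to optimising a
parameter (`condEntropy_le`).

Given uniform approximability, the finitely many unions of atoms of β yield the finite nets, one
point per atom of β yields the Hamming centres, and H(⋁ αᵢ) ≤ H(β) + ∑ H(αᵢ | β) makes the entropy
rate small.

If it fails, a greedy choice produces atoms Aₙ of aₙ ∈ K that stay η-far from every union of atoms
of a₀ ∨ ⋯ ∨ aₙ₋₁. By the chain rule each aₙ adds at least η/2 to the entropy, so the pattern entropy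
is positive. The Aₙ are also pairwise η-separated, which contradicts either kind of precompactness
by pigeonhole. Under bounded mean complexity, most Aᵢ among a₀, …, aₙ₋₁ are close to a set
determined by the trace of Aᵢ on at most C centres; there are at most 2 ^ C traces, so two separated
atoms would be close. -/

open scoped symmDiff

namespace LowComplexity

/-! ### Inequalities for -t log t -/

theorem mul_one_sub_le_negMulLog {p : ℝ} (h0 : 0 ≤ p) : p * (1 - p) ≤ Real.negMulLog p := by
  rcases h0.eq_or_lt with rfl | h
  · simp
  · have := Real.log_le_sub_one_of_pos h
    rw [Real.negMulLog]
    nlinarith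

/-- With s = √p, the bound log s ≥ 1 - 1/s gives -p log p ≤ 2s(1 - s) ≤ 2√(p(1 - p)), and 2x ≤ t +
x²/t removes the root. The result is affine in p(1 - p), so it can be averaged over the atoms of a
partition. -/
theorem negMulLog_le_add_div {p t : ℝ} (h0 : 0 ≤ p) (h1 : p ≤ 1) (ht : 0 < t) :
    Real.negMulLog p ≤ t + p * (1 - p) / t := by
  rcases h0.eq_or_lt with rfl | h
  · simp [ht.le]
  set s := √p with hs
  have hs0 : 0 < s := Real.sqrt_pos.2 h
  have hs1 : s ≤ 1 := Real.sqrt_le_one.2 h1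
  have hp : p = s ^ 2 := (Real.sq_sqrt h0).symm
  have hl : Real.negMulLog p ≤ 2 * (s * (1 - s)) := by
    have h2 := Real.one_sub_inv_le_log_of_pos hs0
    have h3 : s * s⁻¹ = 1 := mul_inv_cancel₀ hs0.ne'
    rw [Real.negMulLog, hp, Real.log_pow]
    push_cast
    have h4 := mul_le_mul_of_nonneg_left h2 (by positivity : 0 ≤ 2 * s ^ 2)
    have h5 : 2 * s ^ 2 * (1 - s⁻¹) = -(2 * (s * (1 - s))) := by
      linear_combination (-2 * s) * h3
    linarith
  have h6 : (s * (1 - s)) ^ 2 ≤ p * (1 - p) := by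
    rw [hp]
    have : 0 ≤ s ^ 2 * (1 - s) * (2 * s) :=
      mul_nonneg (mul_nonneg (sq_nonneg s) (by linarith)) (by linarith)
    nlinarith
  refine hl.trans ?_
  rw [← sub_le_iff_le_add', le_div_iff₀ ht]
  nlinarith [sq_nonneg (t - s * (1 - s))]

/-- Gibbs' inequality for a single summand. -/
theorem negMulLog_le_of_nonneg {p q : ℝ} (hp : 0 ≤ p) (hq : 0 ≤ q) (h : q = 0 → p = 0) :
    Real.negMulLog p ≤ -(p * Real.log q) + q - p := by
  rcases hp.eq_or_lt with rfl | hp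
  · simpa using hq
  have hq : 0 < q := hq.lt_of_ne fun h' => hp.ne' (h h'.symm)
  have h1 := Real.log_le_sub_one_of_pos (div_pos hq hp)
  rw [Real.log_div hq.ne' hp.ne'] at h1
  have h2 := mul_le_mul_of_nonneg_left h1 hp.le
  rw [mul_sub, mul_sub, mul_div_cancel₀ _ hp.ne'] at h2
  rw [Real.negMulLog]
  linarith

theorem negMulLog_sum_le {ι : Type*} (s : Finset ι) (f : ι → ℝ) (hf : ∀ i ∈ s, 0 ≤ f i) :
    Real.negMulLog (∑ i ∈ s, f i) ≤ ∑ i ∈ s, Real.negMulLog (f i) := by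
  rw [Real.negMulLog, neg_mul, Finset.sum_mul, ← Finset.sum_neg_distrib]
  refine Finset.sum_le_sum fun i hi => ?_
  rw [Real.negMulLog, neg_mul]
  rcases (hf i hi).eq_or_lt with h | h
  · simp [← h]
  · have := Real.log_le_log h (Finset.single_le_sum hf hi)
    nlinarith

/-! ### Approximation by unions of atoms, conditional variance and conditional entropy -/

namespace FinPart

theorem symmDiff_biUnion_inter_of_mem {X : Type*} {S : Finset (Set X)} (A : Set X)
    {B : Set X} (hB : B ∈ S) : A ∆ (⋃ C ∈ S, C) ∩ B = B \ A := by
  ext x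
  have : x ∈ B → x ∈ ⋃ C ∈ S, C := fun h => Set.mem_iUnion₂.2 ⟨B, hB, h⟩
  simp only [Set.mem_inter_iff, Set.mem_symmDiff, Set.mem_sdiff]
  tauto

variable {X : Type*} [MeasurableSpace X] {μ : Measure X}

theorem measurableSet_biUnion (β : FinPart μ) {S : Finset (Set X)} (hS : S ⊆ β.atoms) :
    MeasurableSet (⋃ B ∈ S, B) :=
  S.measurableSet_biUnion fun B hB => β.measurableSet B (hS hB)

theorem symmDiff_biUnion_inter_of_notMem (β : FinPart μ) {S : Finset (Set X)}
    (hS : S ⊆ β.atoms) (A : Set X) {B : Set X} (hB : B ∈ β.atoms) (hBS : B ∉ S) :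
    A ∆ (⋃ C ∈ S, C) ∩ B = A ∩ B := by
  ext x
  have : x ∈ B → x ∉ ⋃ C ∈ S, C := by
    intro h h'
    obtain ⟨C, hC, hx⟩ := Set.mem_iUnion₂.1 h'
    exact Set.disjoint_left.1 (β.disjoint B hB C (hS hC) fun e => hBS (e ▸ hC)) h hx
  simp only [Set.mem_inter_iff, Set.mem_symmDiff]
  tauto

/-- Two different tuples of atoms can have the same intersection only if it is empty, so `φ ∅ = 0`
makes the collisions harmless. -/
theorem sum_iJoin {ι : Type*} [Fintype ι] [DecidableEq ι] (α : ι → FinPart μ) (φ : Set X → ℝ)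
    (hφ : φ ∅ = 0) :
    ∑ C ∈ (iJoin α).atoms, φ C =
      ∑ f ∈ Fintype.piFinset fun i => (α i).atoms, φ (⋂ i, f i) := by
  classical
  refine Eq.trans (Finset.sum_congr (by simp only [iJoin]) fun _ _ => rfl)
    (Finset.sum_image_of_pairwise_eq_zero ?_)
  intro f hf g hg hfg h
  obtain ⟨i, hi⟩ := Function.ne_iff.1 hfg
  have hf' := Fintype.mem_piFinset.1 hf i
  have hg' := Fintype.mem_piFinset.1 hg i
  have : (⋂ i, f i) = ∅ := by
    refine Set.eq_empty_iff_forall_notMem.2 fun x hx => ?_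
    have hx' := h ▸ hx
    exact Set.disjoint_left.1 ((α i).disjoint _ hf' _ hg' hi) (Set.mem_iInter.1 hx i)
      (Set.mem_iInter.1 hx' i)
  simp only [this, hφ]

theorem iJoin_finer_apply {ι : Type*} [Fintype ι] [DecidableEq ι] (α : ι → FinPart μ) (i : ι) :
    (iJoin α).Finer (α i) := by
  classical
  intro A hA
  refine ⟨((Fintype.piFinset fun i => (α i).atoms).filter fun f => f i = A).image
    fun f => ⋂ i, f i, ?_, ?_⟩
  · rw [iJoin]
    exact Finset.image_subset_image (Finset.filter_subset _ _)
  · have h : ∀ᵐ x ∂μ, ∀ i, ∃ A ∈ (α i).atoms, x ∈ A := ae_all_iff.2 fun i => (α i).cover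
    filter_upwards [h] with x hx
    choose f hf hxf using hx
    refine propext ⟨fun hxA => Set.mem_iUnion₂.2 ⟨⋂ i, f i, ?_, Set.mem_iInter.2 hxf⟩,
      fun hxA => ?_⟩
    · refine Finset.mem_image_of_mem _ (Finset.mem_filter.2 ⟨Fintype.mem_piFinset.2 hf, ?_⟩)
      by_contra hne
      exact Set.disjoint_left.1 ((α i).disjoint _ (hf i) _ hA hne) (hxf i) hxA
    · obtain ⟨C, hC, hxC⟩ := Set.mem_iUnion₂.1 hxA
      obtain ⟨g, hg, rfl⟩ := Finset.mem_image.1 hC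
      exact (Finset.mem_filter.1 hg).2 ▸ Set.mem_iInter.1 hxC i

theorem exists_symmDiff_lt_of_finer {β γ : FinPart μ} (h : γ.Finer β) {A : Set X} {η : ℝ}
    (hA : ∃ S ⊆ β.atoms, μ.real (A ∆ (⋃ B ∈ S, B)) < η) :
    ∃ S ⊆ γ.atoms, μ.real (A ∆ (⋃ B ∈ S, B)) < η := by
  classical
  obtain ⟨S, hS, hAS⟩ := hA
  choose! T hT hBT using h
  refine ⟨S.biUnion T, fun C hC => ?_, ?_⟩
  · obtain ⟨B, hB, hC⟩ := Finset.mem_biUnion.1 hC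
    exact hT B (hS hB) hC
  · have h : (⋃ C ∈ S.biUnion T, C : Set X) =ᵐ[μ] ⋃ B ∈ S, B := by
      rw [Finset.set_biUnion_biUnion]
      exact Filter.EventuallyEq.countable_bUnion S.countable_toSet
        fun B hB => (hBT B (hS hB)).symm
    have h' : (A ∆ (⋃ C ∈ S.biUnion T, C) : Set X) =ᵐ[μ] (A ∆ (⋃ B ∈ S, B) : Set X) :=
      (ae_eq_refl A).symmDiff h
    rwa [measureReal_congr h']

variable [IsProbabilityMeasure μ]

theorem sum_measureReal_inter (β : FinPart μ) {C : Set X} (hC : MeasurableSet C) :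
    ∑ B ∈ β.atoms, μ.real (C ∩ B) = μ.real C := by
  rw [← measureReal_biUnion_finset (fun A hA B hB h =>
      ((β.disjoint A hA B hB h).mono Set.inter_subset_right Set.inter_subset_right))
      fun B hB => hC.inter (β.measurableSet B hB)]
  refine measureReal_congr ?_
  filter_upwards [β.cover] with x hx
  obtain ⟨B, hB, hx⟩ := hx
  refine propext ⟨fun h => ?_, fun h => Set.mem_iUnion₂.2 ⟨B, hB, h, hx⟩⟩
  obtain ⟨_, _, h, _⟩ := Set.mem_iUnion₂.1 h
  exact h

theorem sum_measureReal (β : FinPart μ) : ∑ B ∈ β.atoms, μ.real B = 1 := by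
  simpa using β.sum_measureReal_inter MeasurableSet.univ

/-- The mean conditional variance of `𝟏_A` given the partition `β`. -/
noncomputable def meanVariance (β : FinPart μ) (A : Set X) : ℝ :=
  ∑ B ∈ β.atoms, μ.real B * (μ.real (A ∩ B) / μ.real B * (1 - μ.real (A ∩ B) / μ.real B))

theorem measureReal_diff_eq {A B : Set X} (hA : MeasurableSet A) :
    μ.real (B \ A) = μ.real B - μ.real (A ∩ B) := by
  rw [eq_sub_iff_add_eq, Set.inter_comm, add_comm]
  exact measureReal_inter_add_sdiff hA

theorem ratio_le_one (A B : Set X) : μ.real (A ∩ B) / μ.real B ≤ 1 :=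
  div_le_one_of_le₀ (measureReal_mono Set.inter_subset_right) measureReal_nonneg

/-- On an atom B with p = μ(A | B), the error of S is μ(B)(1 - p) or μ(B)p, according to whether B
belongs to S; both dominate μ(B)p(1 - p). -/
theorem meanVariance_le (β : FinPart μ) {A : Set X} (hA : MeasurableSet A)
    {S : Finset (Set X)} (hS : S ⊆ β.atoms) :
    β.meanVariance A ≤ μ.real (A ∆ (⋃ B ∈ S, B)) := by
  rw [← β.sum_measureReal_inter (hA.symmDiff (β.measurableSet_biUnion hS)), meanVariance]
  refine Finset.sum_le_sum fun B hB => ?_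
  have h1 : 0 ≤ μ.real (A ∩ B) / μ.real B := by positivity
  have h2 : μ.real (A ∩ B) / μ.real B ≤ 1 := ratio_le_one A B
  have h3 : μ.real B * (μ.real (A ∩ B) / μ.real B) = μ.real (A ∩ B) := by
    rcases eq_or_ne (μ.real B) 0 with h | h
    · have : μ.real (A ∩ B) ≤ μ.real B := measureReal_mono Set.inter_subset_right
      rw [h, zero_mul]
      exact le_antisymm measureReal_nonneg (h ▸ this)
    · exact mul_div_cancel₀ _ h
  have h4 : 0 ≤ μ.real B := measureReal_nonneg
  by_cases hBS : B ∈ S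
  · rw [symmDiff_biUnion_inter_of_mem A hBS, measureReal_diff_eq hA]
    nlinarith [mul_nonneg h4 (mul_self_nonneg (1 - μ.real (A ∩ B) / μ.real B))]
  · rw [β.symmDiff_biUnion_inter_of_notMem hS A hB hBS]
    nlinarith [mul_nonneg h4 (mul_self_nonneg (μ.real (A ∩ B) / μ.real B))]

/-- Majority rule: taking the atoms with p ≥ 1/2 leaves the error min(p, 1 - p) ≤ 2p(1 - p) on each
atom. -/
theorem exists_measureReal_symmDiff_le (β : FinPart μ) {A : Set X} (hA : MeasurableSet A) :
    ∃ S ⊆ β.atoms, μ.real (A ∆ (⋃ B ∈ S, B)) ≤ 2 * β.meanVariance A := by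
  classical
  refine ⟨β.atoms.filter fun B => 1 / 2 ≤ μ.real (A ∩ B) / μ.real B, Finset.filter_subset _ _, ?_⟩
  have hS := Finset.filter_subset (fun B => 1 / 2 ≤ μ.real (A ∩ B) / μ.real B) β.atoms
  rw [← β.sum_measureReal_inter (hA.symmDiff (β.measurableSet_biUnion hS)), meanVariance,
    Finset.mul_sum]
  refine Finset.sum_le_sum fun B hB => ?_
  have h1 : 0 ≤ μ.real (A ∩ B) / μ.real B := by positivity
  have h2 : μ.real (A ∩ B) / μ.real B ≤ 1 := ratio_le_one A B
  have h3 : μ.real B * (μ.real (A ∩ B) / μ.real B) = μ.real (A ∩ B) := by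
    rcases eq_or_ne (μ.real B) 0 with h | h
    · have : μ.real (A ∩ B) ≤ μ.real B := measureReal_mono Set.inter_subset_right
      rw [h, zero_mul]
      exact le_antisymm measureReal_nonneg (h ▸ this)
    · exact mul_div_cancel₀ _ h
  have h4 : 0 ≤ μ.real B := measureReal_nonneg
  by_cases hBS : 1 / 2 ≤ μ.real (A ∩ B) / μ.real B
  · rw [symmDiff_biUnion_inter_of_mem A (Finset.mem_filter.2 ⟨hB, hBS⟩),
      measureReal_diff_eq hA]
    generalize μ.real (A ∩ B) / μ.real B = p at *
    nlinarith [mul_nonneg h4 (mul_nonneg (sub_nonneg.2 h2) (sub_nonneg.2 hBS))]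
  · rw [β.symmDiff_biUnion_inter_of_notMem hS A hB
      fun h => hBS (Finset.mem_filter.1 h).2]
    generalize μ.real (A ∩ B) / μ.real B = p at *
    nlinarith [mul_nonneg h4 (mul_nonneg h1 (sub_nonneg.2 (not_le.1 hBS).le))]

theorem meanVariance_le_condEntropy (α β : FinPart μ) {A : Set X} (hA : A ∈ α.atoms) :
    β.meanVariance A ≤ α.condEntropy β := by
  refine Finset.sum_le_sum fun B _ => mul_le_mul_of_nonneg_left ?_ measureReal_nonneg
  refine (mul_one_sub_le_negMulLog (by positivity)).trans ?_
  exact Finset.single_le_sum (f := fun A => Real.negMulLog (μ.real (A ∩ B) / μ.real B))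
    (fun A _ => Real.negMulLog_nonneg (by positivity) (ratio_le_one A B)) hA

theorem condEntropy_nonneg (α β : FinPart μ) : 0 ≤ α.condEntropy β :=
  Finset.sum_nonneg fun B _ => mul_nonneg measureReal_nonneg <| Finset.sum_nonneg fun A _ =>
    Real.negMulLog_nonneg (by positivity) (ratio_le_one A B)

/-- Each atom of α contributes at most t + η/t, by averaging `negMulLog_le_add_div` over β. The
parameter t is left free; the applications take η = t². -/
theorem condEntropy_le (α β : FinPart μ) {r : ℕ} (hr : α.atoms.card ≤ r) {η t : ℝ}
    (hη : 0 ≤ η) (ht : 0 < t)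
    (h : ∀ A ∈ α.atoms, ∃ S ⊆ β.atoms, μ.real (A ∆ (⋃ B ∈ S, B)) ≤ η) :
    α.condEntropy β ≤ r * (t + η / t) := by
  have h1 : ∀ A ∈ α.atoms,
      ∑ B ∈ β.atoms, μ.real B * Real.negMulLog (μ.real (A ∩ B) / μ.real B) ≤ t + η / t := by
    intro A hA
    obtain ⟨S, hS, hAS⟩ := h A hA
    have h2 := (β.meanVariance_le (α.measurableSet A hA) hS).trans hAS
    calc _ ≤ ∑ B ∈ β.atoms, (μ.real B * t + μ.real B *
          (μ.real (A ∩ B) / μ.real B * (1 - μ.real (A ∩ B) / μ.real B)) / t) := by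
          refine Finset.sum_le_sum fun B _ => ?_
          rw [mul_div_assoc, ← mul_add]
          exact mul_le_mul_of_nonneg_left
            (negMulLog_le_add_div (by positivity) (ratio_le_one A B) ht) measureReal_nonneg
      _ = t + β.meanVariance A / t := by
          rw [Finset.sum_add_distrib, ← Finset.sum_mul, ← Finset.sum_div, β.sum_measureReal,
            one_mul, meanVariance]
      _ ≤ _ := by gcongr
  calc α.condEntropy β = ∑ A ∈ α.atoms, ∑ B ∈ β.atoms,
        μ.real B * Real.negMulLog (μ.real (A ∩ B) / μ.real B) := by
        rw [Finset.sum_comm]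
        exact Finset.sum_congr rfl fun B _ => Finset.mul_sum _ _ _
    _ ≤ ∑ A ∈ α.atoms, (t + η / t) := Finset.sum_le_sum h1
    _ = α.atoms.card * (t + η / t) := by rw [Finset.sum_const, nsmul_eq_mul]
    _ ≤ _ := by gcongr

/-! ### Entropy of joins: subadditivity and the chain rule -/

section Join

variable {ι : Type*} [Fintype ι] [DecidableEq ι]

theorem sum_piFinset_measureReal (α : ι → FinPart μ) {C : Set X} (hC : MeasurableSet C) :
    ∑ f ∈ Fintype.piFinset fun i => (α i).atoms, μ.real (C ∩ ⋂ i, f i) = μ.real C := by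
  rw [← (iJoin α).sum_measureReal_inter hC, sum_iJoin α (fun B => μ.real (C ∩ B)) (by simp)]

/-- Subadditivity of the entropy function on a fixed set `B`. -/
theorem sum_negMulLog_inter_le (α : ι → FinPart μ) {B : Set X} (hB : MeasurableSet B) :
    ∑ f ∈ Fintype.piFinset fun i => (α i).atoms, Real.negMulLog (μ.real (B ∩ ⋂ i, f i)) ≤
      Real.negMulLog (μ.real B) +
        ∑ i, μ.real B * ∑ A ∈ (α i).atoms, Real.negMulLog (μ.real (A ∩ B) / μ.real B) := by
  classical
  set n := μ.real B with hn
  set P : (ι → Set X) → ℝ := fun f => μ.real (B ∩ ⋂ i, f i) with hP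
  set I := Fintype.piFinset fun i => (α i).atoms with hI
  have hPn : ∀ f, P f ≤ n := fun f => measureReal_mono Set.inter_subset_left
  have hP0 : ∀ f, 0 ≤ P f := fun f => measureReal_nonneg
  rcases eq_or_lt_of_le (show 0 ≤ n from measureReal_nonneg) with h0 | h0
  · have : ∀ f, P f = 0 := fun f => le_antisymm (h0 ▸ hPn f) (hP0 f)
    change ∑ f ∈ I, Real.negMulLog (P f) ≤ _
    simp [this, h0.symm]
  set p : ι → Set X → ℝ := fun i A => μ.real (A ∩ B) / n with hp
  have hp0 : ∀ i A, 0 ≤ p i A := fun i A => by positivity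
  have hPp : ∀ f i, P f ≤ μ.real (f i ∩ B) := fun f i =>
    measureReal_mono fun x hx => ⟨Set.mem_iInter.1 hx.2 i, hx.1⟩
  -- Gibbs' inequality against the product of the conditional marginals on B, scaled to mass n =
  -- μ(B). Both weights have total mass n, so the correction terms cancel after summation.
  have key : ∀ f ∈ I, Real.negMulLog (P f) ≤
      P f * (-Real.log n) + ∑ i, -(P f * Real.log (p i (f i))) + (n * ∏ i, p i (f i) - P f) := by
    intro f _
    have hq : n * ∏ i, p i (f i) = 0 → P f = 0 := by
      intro h
      obtain ⟨i, _, hi⟩ := Finset.prod_eq_zero_iff.1 ((mul_eq_zero.1 h).resolve_left h0.ne')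
      have : μ.real (f i ∩ B) = 0 := (div_eq_zero_iff.1 hi).resolve_right h0.ne'
      exact le_antisymm (this ▸ hPp f i) (hP0 f)
    have h1 := negMulLog_le_of_nonneg (hP0 f)
      (mul_nonneg h0.le (Finset.prod_nonneg fun i _ => hp0 i (f i))) hq
    rcases eq_or_ne (P f) 0 with h2 | h2
    · simp only [h2, zero_mul, neg_zero, Finset.sum_const_zero, add_zero, sub_zero,
        Real.negMulLog_zero, zero_add]
      exact mul_nonneg h0.le (Finset.prod_nonneg fun i _ => hp0 i (f i))
    · have h3 : n * ∏ i, p i (f i) ≠ 0 := fun h => h2 (hq h)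
      have h4 := right_ne_zero_of_mul h3
      rw [Real.log_mul h0.ne' h4, Real.log_prod (fun i _ => Finset.prod_ne_zero_iff.1 h4 i
        (Finset.mem_univ i))] at h1
      rw [Finset.sum_neg_distrib, ← Finset.mul_sum]
      linarith
  have hsum : ∑ f ∈ I, P f = n := sum_piFinset_measureReal α hB
  have hprod : ∑ f ∈ I, n * ∏ i, p i (f i) = n := by
    rw [← Finset.mul_sum, ← Finset.prod_univ_sum, Finset.prod_eq_one, mul_one]
    intro i _
    rw [← Finset.sum_div, div_eq_one_iff_eq h0.ne', ← ((α i).sum_measureReal_inter hB).trans hn.symm]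
    exact Finset.sum_congr rfl fun A _ => by rw [Set.inter_comm]
  have hmarg : ∀ i, ∑ f ∈ I, -(P f * Real.log (p i (f i))) =
      n * ∑ A ∈ (α i).atoms, Real.negMulLog (p i A) := by
    intro i
    calc _ = ∑ f ∈ I, ∑ A ∈ (α i).atoms,
          -(μ.real ((A ∩ B) ∩ ⋂ i, f i) * Real.log (p i A)) := by
          refine Finset.sum_congr rfl fun f hf => ?_
          rw [hI, Fintype.mem_piFinset] at hf
          rw [Finset.sum_eq_single_of_mem (f i) (hf i)]
          · have : (f i ∩ B) ∩ ⋂ i, f i = B ∩ ⋂ i, f i := by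
              ext x
              have : x ∈ ⋂ i, f i → x ∈ f i := fun h => Set.mem_iInter.1 h i
              simp only [Set.mem_inter_iff]
              tauto
            rw [this]
          · intro A hA hne
            have : (A ∩ B) ∩ ⋂ i, f i = ∅ := by
              refine Set.eq_empty_iff_forall_notMem.2 fun x hx => ?_
              exact Set.disjoint_left.1 ((α i).disjoint _ hA _ (hf i) hne) hx.1.1
                (Set.mem_iInter.1 hx.2 i)
            simp [this]
      _ = ∑ A ∈ (α i).atoms, -(μ.real (A ∩ B) * Real.log (p i A)) := by
          rw [Finset.sum_comm]
          refine Finset.sum_congr rfl fun A hA => ?_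
          rw [Finset.sum_neg_distrib, ← Finset.sum_mul,
            sum_piFinset_measureReal α (((α i).measurableSet A hA).inter hB)]
      _ = _ := by
          rw [Finset.mul_sum]
          refine Finset.sum_congr rfl fun A _ => ?_
          have : μ.real (A ∩ B) = n * p i A := (mul_div_cancel₀ _ h0.ne').symm
          rw [this, Real.negMulLog]
          ring
  refine (Finset.sum_le_sum key).trans (le_of_eq ?_)
  rw [Finset.sum_add_distrib, Finset.sum_add_distrib, ← Finset.sum_mul, hsum,
    Finset.sum_sub_distrib, hprod, hsum, Finset.sum_comm, Finset.sum_congr rfl fun i _ => hmarg i,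
    Real.negMulLog]
  ring

/-- Cutting every atom of the join along β can only increase the entropy; on each atom of β the
conditional entropies are then subadditive. -/
theorem entropy_iJoin_le (α : ι → FinPart μ) (β : FinPart μ) :
    (iJoin α).entropy ≤ β.entropy + ∑ i, (α i).condEntropy β := by
  calc (iJoin α).entropy = ∑ f ∈ Fintype.piFinset fun i => (α i).atoms,
        Real.negMulLog (μ.real (⋂ i, f i)) :=
        sum_iJoin α (fun C => Real.negMulLog (μ.real C)) (by simp)
    _ ≤ ∑ f ∈ Fintype.piFinset fun i => (α i).atoms, ∑ B ∈ β.atoms,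
        Real.negMulLog (μ.real (B ∩ ⋂ i, f i)) := by
        refine Finset.sum_le_sum fun f hf => ?_
        have hm : MeasurableSet (⋂ i, f i) := MeasurableSet.iInter fun i =>
          (α i).measurableSet _ (Fintype.mem_piFinset.1 hf i)
        rw [← β.sum_measureReal_inter hm]
        simp_rw [Set.inter_comm (⋂ i, f i)]
        exact negMulLog_sum_le _ _ fun _ _ => measureReal_nonneg
    _ ≤ ∑ B ∈ β.atoms, (Real.negMulLog (μ.real B) +
        ∑ i, μ.real B * ∑ A ∈ (α i).atoms, Real.negMulLog (μ.real (A ∩ B) / μ.real B)) := by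
        rw [Finset.sum_comm]
        exact Finset.sum_le_sum fun B hB => sum_negMulLog_inter_le α (β.measurableSet B hB)
    _ = _ := by
        rw [Finset.sum_add_distrib, Finset.sum_comm]
        rfl

end Join

theorem entropy_iJoin_succ {n : ℕ} (α : Fin (n + 1) → FinPart μ) :
    (iJoin α).entropy = (iJoin fun i : Fin n => α i.castSucc).entropy +
      (α (Fin.last n)).condEntropy (iJoin fun i : Fin n => α i.castSucc) := by
  have h1 : ∀ B : Set X, MeasurableSet B →
      Real.negMulLog (μ.real B) + μ.real B * ∑ A ∈ (α (Fin.last n)).atoms,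
        Real.negMulLog (μ.real (A ∩ B) / μ.real B) =
      ∑ A ∈ (α (Fin.last n)).atoms, Real.negMulLog (μ.real (A ∩ B)) := by
    intro B hB
    rcases eq_or_ne (μ.real B) 0 with h0 | h0
    · have : ∀ A, μ.real (A ∩ B) = 0 := fun A =>
        le_antisymm (h0 ▸ measureReal_mono Set.inter_subset_right) measureReal_nonneg
      simp [this, h0]
    -- The product rule for -t log t applied to μ(A ∩ B) = μ(B) μ(A | B); summing over A gives the
    -- chain rule on B.
    · have h2 : ∀ A : Set X, Real.negMulLog (μ.real (A ∩ B)) =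
          μ.real (B ∩ A) * (-Real.log (μ.real B)) +
            μ.real B * Real.negMulLog (μ.real (A ∩ B) / μ.real B) := by
        intro A
        obtain ⟨q, hq⟩ : ∃ q, q = μ.real (A ∩ B) / μ.real B := ⟨_, rfl⟩
        have h3 : μ.real (A ∩ B) = μ.real B * q := by rw [hq, mul_div_cancel₀ _ h0]
        rw [← hq, Set.inter_comm B A, h3]
        simp only [Real.negMulLog_mul]
        simp only [Real.negMulLog]
        ring
      simp_rw [h2]
      rw [Finset.sum_add_distrib, ← Finset.sum_mul, sum_measureReal_inter _ hB, ← Finset.mul_sum,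
        Real.negMulLog]
      ring
  have h2 : (iJoin fun i : Fin n => α i.castSucc).entropy +
      (α (Fin.last n)).condEntropy (iJoin fun i : Fin n => α i.castSucc) =
      ∑ B ∈ (iJoin fun i : Fin n => α i.castSucc).atoms,
        ∑ A ∈ (α (Fin.last n)).atoms, Real.negMulLog (μ.real (A ∩ B)) := by
    rw [entropy, condEntropy, ← Finset.sum_add_distrib]
    exact Finset.sum_congr rfl fun B hB => h1 B ((iJoin _).measurableSet B hB)
  rw [h2, sum_iJoin _ (fun B => ∑ A ∈ (α (Fin.last n)).atoms, Real.negMulLog (μ.real (A ∩ B)))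
    (by simp), entropy, sum_iJoin α (fun C => Real.negMulLog (μ.real C)) (by simp),
    ← Finset.sum_product']
  refine Finset.sum_bij' (fun f _ => (Fin.init f, f (Fin.last n)))
    (fun g _ => Fin.snoc g.1 g.2) ?_ ?_ ?_ ?_ ?_
  · intro f hf
    rw [Fintype.mem_piFinset] at hf
    exact Finset.mem_product.2 ⟨Fintype.mem_piFinset.2 fun i => hf i.castSucc, hf _⟩
  · intro g hg
    obtain ⟨hg1, hg2⟩ := Finset.mem_product.1 hg
    rw [Fintype.mem_piFinset] at hg1
    refine Fintype.mem_piFinset.2 fun i => ?_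
    induction i using Fin.lastCases with
    | last => simpa using hg2
    | cast i => simpa using hg1 i
  · intro f _
    simp
  · intro g _
    simp
  · intro f _
    congr 2
    ext x
    simp only [Set.mem_iInter, Set.mem_inter_iff, Fin.forall_fin_succ', Fin.init]
    tauto

end FinPart

/-! ### Double counting, selections and the L² distance of indicators -/

theorem sum_measureReal_eq_integral {X ι : Type*} [MeasurableSpace X] {μ : Measure X}
    [IsProbabilityMeasure μ] (s : Finset ι) {N : ι → Set X}
    [∀ x, DecidablePred fun i => x ∈ N i] (hN : ∀ i ∈ s, MeasurableSet (N i)) :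
    Integrable (fun x => ((s.filter fun i => x ∈ N i).card : ℝ)) μ ∧
      ∑ i ∈ s, μ.real (N i) = ∫ x, ((s.filter fun i => x ∈ N i).card : ℝ) ∂μ := by
  have h : (fun x => ((s.filter fun i => x ∈ N i).card : ℝ)) =
      fun x => ∑ i ∈ s, (N i).indicator (1 : X → ℝ) x := by
    ext x
    rw [Finset.card_filter]
    push_cast
    exact Finset.sum_congr rfl fun i _ => by simp [Set.indicator_apply]
  have hi : ∀ i ∈ s, Integrable (fun x => (N i).indicator (1 : X → ℝ) x) μ := fun i hi =>
    (integrable_const (1 : ℝ)).indicator (hN i hi)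
  rw [h]
  refine ⟨integrable_finsetSum _ hi, ?_⟩
  rw [integral_finsetSum _ hi]
  exact Finset.sum_congr rfl fun i hi => (integral_indicator_one (hN i hi)).symm

theorem sum_measureReal_le_of_card_le {X ι : Type*} [MeasurableSpace X] {μ : Measure X}
    [IsProbabilityMeasure μ] (s : Finset ι) {N : ι → Set X}
    [∀ x, DecidablePred fun i => x ∈ N i] (hN : ∀ i ∈ s, MeasurableSet (N i))
    {c : ℝ} (h : ∀ x, ((s.filter fun i => x ∈ N i).card : ℝ) ≤ c) :
    ∑ i ∈ s, μ.real (N i) ≤ c := by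
  obtain ⟨h1, h2⟩ := sum_measureReal_eq_integral (μ := μ) s hN
  rw [h2]
  refine (integral_mono h1 (integrable_const c) h).trans ?_
  simp

/-- Markov's inequality for the number of sets that contain a point. -/
theorem mul_measureReal_le_sum {X ι : Type*} [MeasurableSpace X] {μ : Measure X}
    [IsProbabilityMeasure μ] (s : Finset ι) {N : ι → Set X}
    [∀ x, DecidablePred fun i => x ∈ N i] (hN : ∀ i ∈ s, MeasurableSet (N i))
    (c : ℝ) :
    c * μ.real {x | c ≤ ((s.filter fun i => x ∈ N i).card : ℝ)} ≤ ∑ i ∈ s, μ.real (N i) := by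
  obtain ⟨h1, h2⟩ := sum_measureReal_eq_integral (μ := μ) s hN
  rw [h2]
  exact mul_meas_ge_le_integral_of_nonneg (ae_of_all _ fun x => Nat.cast_nonneg _) h1 c

/-- A finite cover by measurable sets admits a measurable selection. -/
theorem exists_measurable_selection {X ι : Type*} [MeasurableSpace X] [Nonempty ι]
    (D : Finset ι) (U : ι → Set X) (hU : ∀ i, MeasurableSet (U i)) :
    ∃ c : X → ι, (∀ S : Set ι, MeasurableSet (c ⁻¹' S)) ∧
      ∀ y ∈ ⋃ i ∈ D, U i, c y ∈ D ∧ y ∈ U (c y) := by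
  classical
  induction D using Finset.induction_on with
  | empty =>
    obtain ⟨i⟩ := ‹Nonempty ι›
    exact ⟨fun _ => i, fun S => by by_cases h : i ∈ S <;> simp [h], by simp⟩
  | insert i D _ ih =>
    obtain ⟨c, hc, hcD⟩ := ih
    refine ⟨(U i).piecewise (fun _ => i) c, fun S => ?_, fun y hy => ?_⟩
    · rw [Set.piecewise_preimage]
      exact (hU i).ite (by by_cases h : i ∈ S <;> simp [h]) (hc S)
    · by_cases hyi : y ∈ U i
      · simp [hyi]
      · have hy' : y ∈ ⋃ i ∈ D, U i := by simpa [hyi] using hy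
        simpa [hyi] using ⟨Or.inr (hcD y hy').1, (hcD y hy').2⟩

/-- Strong recursion behind the greedy construction: each term may depend on all earlier ones. -/
theorem exists_seq_of_forall_tuple {T : Type*} (P : ∀ n : ℕ, (Fin n → T) → T → Prop)
    (h : ∀ n f, ∃ t, P n f t) : ∃ a : ℕ → T, ∀ n, P n (fun i => a i) (a n) := by
  choose g hg using h
  let a : ℕ → T := fun n => Nat.strongRec (fun n ih => g n fun i => ih i i.2) n
  refine ⟨a, fun n => ?_⟩
  have : a n = g n fun i => a i := by
    simp only [a]
    rw [Nat.strongRec_eq]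
  rw [this]
  exact hg n _

theorem dist_indicatorConstLp_two {X : Type*} [MeasurableSpace X] {μ : Measure X}
    [IsFiniteMeasure μ] {A B : Set X} (hA : MeasurableSet A) (hB : MeasurableSet B) :
    dist (indicatorConstLp 2 hA (measure_ne_top μ A) (1 : ℝ))
      (indicatorConstLp 2 hB (measure_ne_top μ B) (1 : ℝ)) = √(μ.real (A ∆ B)) := by
  rw [dist_indicatorConstLp_eq_norm, norm_indicatorConstLp (by simp) (by simp),
    Real.sqrt_eq_rpow]
  simp

/-! ### Uniform approximability and the two kinds of precompactness -/

namespace Partitions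

variable {X : Type*} [MeasurableSpace X] {μ : Measure X}

theorem mk_out (a : Partitions μ) : mk (Quotient.out a) = a := Quotient.out_eq a

theorem entropy_iJoin_eq {ι : Type*} [Fintype ι] [DecidableEq ι] {a : ι → Partitions μ}
    {α : ι → FinPart μ} (h : ∀ i, mk (α i) = a i) :
    entropy (iJoin a) = (FinPart.iJoin α).entropy := by
  rw [← funext h, iJoin_mk]
  rfl

/-- The atoms of the members of `K` are approximated, uniformly, by unions of atoms of a single
finite partition. -/
def UniformlyApproximable (rep : Partitions μ → FinPart μ) (K : Set (Partitions μ)) : Prop :=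
  ∀ η : ℝ, 0 < η → ∃ β : FinPart μ, ∀ a ∈ K, ∀ A ∈ (rep a).atoms,
    ∃ S ⊆ β.atoms, μ.real (A ∆ (⋃ B ∈ S, B)) < η

variable {rep : Partitions μ → FinPart μ} {K : Set (Partitions μ)}

/-- No finite partition works for η, in particular not the join of the members chosen so far; the
atom witnessing this is the next choice. -/
theorem exists_seq_of_not_uniformlyApproximable (h : ¬ UniformlyApproximable rep K) :
    ∃ η > 0, ∃ (a : ℕ → Partitions μ) (A : ℕ → Set X), (∀ n, a n ∈ K) ∧
      (∀ n, A n ∈ (rep (a n)).atoms) ∧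
      ∀ n, ∀ S ⊆ (FinPart.iJoin fun i : Fin n => rep (a i)).atoms,
        η ≤ μ.real (A n ∆ (⋃ B ∈ S, B)) := by
  simp only [UniformlyApproximable] at h
  push Not at h
  obtain ⟨η, hη, h⟩ := h
  obtain ⟨p, hp⟩ := exists_seq_of_forall_tuple (T := Partitions μ × Set X)
    (fun n f p => p.1 ∈ K ∧ p.2 ∈ (rep p.1).atoms ∧
      ∀ S ⊆ (FinPart.iJoin fun i : Fin n => rep (f i).1).atoms,
        η ≤ μ.real (p.2 ∆ (⋃ B ∈ S, B))) (fun n f => by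
      obtain ⟨a, ha, A, hA, hS⟩ := h (FinPart.iJoin fun i : Fin n => rep (f i).1)
      exact ⟨(a, A), ha, hA, hS⟩)
  exact ⟨η, hη, fun n => (p n).1, fun n => (p n).2, fun n => (hp n).1, fun n => (hp n).2.1,
    fun n => (hp n).2.2⟩

theorem exists_separated_seq (h : ¬ UniformlyApproximable rep K) [IsProbabilityMeasure μ] :
    ∃ η > 0, ∃ (a : ℕ → Partitions μ) (A : ℕ → Set X), (∀ n, a n ∈ K) ∧ a.Injective ∧
      (∀ n, A n ∈ (rep (a n)).atoms) ∧ ∀ m n, m ≠ n → η ≤ μ.real (A m ∆ A n) := by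
  obtain ⟨η, hη, a, A, ha, hA, h⟩ := exists_seq_of_not_uniformlyApproximable h
  -- Needed for every atom of `rep (a m)`, not only for `A m`: if `a m = a n`, then `A n` is such an
  -- atom, at distance 0 from itself, which yields injectivity.
  have h1 : ∀ m n, m < n → ∀ B ∈ (rep (a m)).atoms, η ≤ μ.real (A n ∆ B) := by
    intro m n hmn B hB
    by_contra! hlt
    obtain ⟨S, hS, hlt⟩ := FinPart.exists_symmDiff_lt_of_finer (η := η) (A := A n)
      (FinPart.iJoin_finer_apply (fun i : Fin n => rep (a i)) ⟨m, hmn⟩)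
      ⟨{B}, by simpa using hB, by simpa using hlt⟩
    exact hlt.not_ge (h n S hS)
  refine ⟨η, hη, a, A, ha, ?_, hA, ?_⟩
  · intro m n hmn
    by_contra hne
    rcases lt_or_gt_of_ne hne with hlt | hlt
    · have := h1 m n hlt (A n) (hmn ▸ hA n)
      simp at this
      linarith
    · have := h1 n m hlt (A m) (hmn ▸ hA m)
      simp at this
      linarith
  · intro m n hne
    rcases lt_or_gt_of_ne hne with hlt | hlt
    · rw [symmDiff_comm]
      exact h1 m n hlt _ (hA m)
    · exact h1 n m hlt _ (hA n)

variable [IsProbabilityMeasure μ]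

theorem uniformlyApproximable_of_totallyBounded (h : TotallyBounded (atomIndicators rep K)) :
    UniformlyApproximable rep K := by
  by_contra hn
  obtain ⟨η, hη, a, A, ha, -, hA, hsep⟩ := exists_separated_seq hn
  obtain ⟨t, ht, hcov⟩ := Metric.totallyBounded_iff.1 h (√η / 2) (by positivity)
  have hm : ∀ n, ∃ y : t, dist (indicatorConstLp 2 ((rep (a n)).measurableSet _ (hA n))
      (measure_ne_top μ (A n)) (1 : ℝ)) y < √η / 2 := by
    intro n
    obtain ⟨y, hy, hd⟩ := Set.mem_iUnion₂.1 (hcov ⟨a n, ha n, A n, hA n, rfl⟩)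
    exact ⟨⟨y, hy⟩, hd⟩
  choose y hy using hm
  have := ht.to_subtype
  obtain ⟨m, n, hmn, hymn⟩ := Finite.exists_ne_map_eq_of_infinite y
  have h1 := dist_triangle_right (indicatorConstLp 2 ((rep (a m)).measurableSet _ (hA m))
      (measure_ne_top μ (A m)) (1 : ℝ)) (indicatorConstLp 2 ((rep (a n)).measurableSet _ (hA n))
      (measure_ne_top μ (A n)) (1 : ℝ)) (y m : Lp ℝ 2 μ)
  rw [dist_indicatorConstLp_two] at h1
  have h2 := hy m
  have h3 := hy n
  rw [← hymn] at h3
  exact (Real.sqrt_le_sqrt (hsep m n hmn)).not_gt (by linarith)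

theorem UniformlyApproximable.totallyBounded (h : UniformlyApproximable rep K) :
    TotallyBounded (atomIndicators rep K) := by
  refine Metric.totallyBounded_iff.2 fun ε hε => ?_
  obtain ⟨β, hβ⟩ := h (ε ^ 2) (by positivity)
  refine ⟨Set.range fun S : β.atoms.powerset => indicatorConstLp 2
    (β.measurableSet_biUnion (Finset.mem_powerset.1 S.2)) (measure_ne_top μ _) (1 : ℝ),
    Set.finite_range _, ?_⟩
  rintro _ ⟨a, ha, A, hA, rfl⟩
  obtain ⟨S, hS, hAS⟩ := hβ a ha A hA
  refine Set.mem_iUnion₂.2 ⟨_, ⟨⟨S, Finset.mem_powerset.2 hS⟩, rfl⟩, ?_⟩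
  rw [Metric.mem_ball, dist_indicatorConstLp_two]
  exact (Real.sqrt_lt' hε).2 hAS

/-- Rokhlin distance below η/4 to a net point puts `A n` within η/2 of a union of its atoms. A
finite net has finitely many such unions, so two separated atoms share one. -/
theorem uniformlyApproximable_of_rokhlinPrecompact {r : ℕ} (hrep : IsRepresentation r K rep)
    (h : RokhlinPrecompact r K) : UniformlyApproximable rep K := by
  by_contra hn
  obtain ⟨η, hη, a, A, ha, -, hA, hsep⟩ := exists_separated_seq hn
  obtain ⟨F, hF, -, hnet⟩ := h (η / 4) (by positivity)
  have key : ∀ n, ∃ S ∈ ⋃ b ∈ F, ((Quotient.out b).atoms.powerset : Set (Finset (Set X))),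
      μ.real (A n ∆ (⋃ B ∈ S, B)) < η / 2 := by
    intro n
    obtain ⟨b, hb, hab⟩ := hnet (a n) (ha n)
    have h1 : (rep (a n)).condEntropy (Quotient.out b) ≤ rokhlin (a n) b := by
      rw [← (hrep (a n) (ha n)).1, ← mk_out b]
      nth_rewrite 1 [(hrep (a n) (ha n)).1]
      nth_rewrite 1 [mk_out b]
      exact le_add_of_nonneg_right (FinPart.condEntropy_nonneg _ _)
    obtain ⟨S, hS, hAS⟩ := (Quotient.out b).exists_measureReal_symmDiff_le
      ((rep (a n)).measurableSet _ (hA n))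
    have h2 := (rep (a n)).meanVariance_le_condEntropy (Quotient.out b) (hA n)
    exact ⟨S, Set.mem_iUnion₂.2 ⟨b, hb, by simpa using hS⟩, by linarith⟩
  choose S hS hAS using key
  have hfin : (⋃ b ∈ F, ((Quotient.out b).atoms.powerset : Set (Finset (Set X)))).Finite :=
    hF.biUnion fun b _ => Finset.finite_toSet _
  have := hfin.to_subtype
  obtain ⟨m, n, hmn, hSmn⟩ := Finite.exists_ne_map_eq_of_infinite fun n =>
    (⟨S n, hS n⟩ : ↥(⋃ b ∈ F, ((Quotient.out b).atoms.powerset : Set (Finset (Set X)))))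
  have hSmn : S m = S n := congrArg Subtype.val hSmn
  have h1 := hAS m
  have h2 := hAS n
  rw [hSmn] at h1
  rw [symmDiff_comm] at h2
  have h3 := measureReal_symmDiff_le (μ := μ) (s := A m) (t := ⋃ B ∈ S n, B) (A n)
    (measure_ne_top μ _) (measure_ne_top μ _)
  linarith [hsep m n hmn]

theorem UniformlyApproximable.rokhlinPrecompact {r : ℕ} (hK : K ⊆ atMost μ r)
    (hrep : IsRepresentation r K rep) (h : UniformlyApproximable rep K) :
    RokhlinPrecompact r K := by
  classical
  intro ε hε
  set t := ε / (8 * (r + 1)) with ht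
  have ht0 : 0 < t := by positivity
  obtain ⟨β, hβ⟩ := h (t ^ 2 / 2) (by positivity)
  -- The signature of a: all unions of atoms of β close to some atom of a. There are finitely many
  -- signatures, and partitions with equal signatures have atoms pairwise within t². The net `F`
  -- takes one member of `K` per signature, so it stays inside `atMost μ r`.
  set Φ : Partitions μ → Finset (Finset (Set X)) := fun a =>
    β.atoms.powerset.filter fun S => ∃ A ∈ (rep a).atoms, μ.real (A ∆ (⋃ B ∈ S, B)) < t ^ 2 / 2
    with hΦ
  obtain ⟨F, hFK, hF⟩ := Set.exists_subset_bijOn K Φ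
  have hfin : F.Finite := by
    refine Set.Finite.of_finite_image (f := Φ) ?_ hF.injOn
    refine (Finset.finite_toSet β.atoms.powerset.powerset).subset ?_
    rintro _ ⟨a, -, rfl⟩
    exact Finset.mem_powerset.2 (Finset.filter_subset _ _)
  have key : ∀ a ∈ K, ∀ b ∈ K, Φ a = Φ b → condEntropy a b < ε / 2 := by
    intro a ha b hb hab
    have h1 : condEntropy a b = (rep a).condEntropy (rep b) := by
      conv_lhs => rw [← (hrep a ha).1, ← (hrep b hb).1]
      rfl
    rw [h1]
    refine ((rep a).condEntropy_le (rep b) (hrep a ha).2 (η := t ^ 2) (by positivity) ht0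
      ?_).trans_lt ?_
    · intro A hA
      obtain ⟨S, hS, hAS⟩ := hβ a ha A hA
      have h2 : S ∈ Φ a := Finset.mem_filter.2 ⟨Finset.mem_powerset.2 hS, A, hA, hAS⟩
      rw [hab] at h2
      obtain ⟨-, B, hB, hBS⟩ := Finset.mem_filter.1 h2
      refine ⟨{B}, by simpa using hB, ?_⟩
      rw [symmDiff_comm] at hBS
      have h3 := measureReal_symmDiff_le (μ := μ) (s := A) (t := ⋃ B ∈ S, B) B
        (measure_ne_top μ _) (measure_ne_top μ _)
      simp only [Finset.mem_singleton, Set.iUnion_iUnion_eq_left]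
      linarith
    · have h2 : t ^ 2 / t = t := by field_simp
      have h3 : (r + 1) * t = ε / 8 := by rw [ht]; field_simp
      rw [h2]
      linarith
  refine ⟨F, hfin, hFK.trans hK, fun a ha => ?_⟩
  obtain ⟨b, hb, hab⟩ := hF.surjOn ⟨a, ha, rfl⟩
  have h1 := key a ha b (hFK hb) hab.symm
  have h2 := key b (hFK hb) a ha hab
  exact ⟨b, hb, by rw [rokhlin]; linarith⟩

/-! ### Maximal pattern entropy -/

theorem UniformlyApproximable.exists_condEntropy_le {r : ℕ} (hrep : IsRepresentation r K rep)
    (h : UniformlyApproximable rep K) {ε : ℝ} (hε : 0 < ε) :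
    ∃ β : FinPart μ, ∀ a ∈ K, (rep a).condEntropy β ≤ ε := by
  set t := ε / (2 * (r + 1)) with ht
  have ht0 : 0 < t := by positivity
  obtain ⟨β, hβ⟩ := h (t ^ 2) (by positivity)
  refine ⟨β, fun a ha => ((rep a).condEntropy_le β (hrep a ha).2 (η := t ^ 2) (by positivity) ht0
    fun A hA => ?_).trans ?_⟩
  · obtain ⟨S, hS, hAS⟩ := hβ a ha A hA
    exact ⟨S, hS, hAS.le⟩
  · have h2 : t ^ 2 / t = t := by field_simp
    have h3 : (r + 1) * t = ε / 2 := by rw [ht]; field_simp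
    rw [h2]
    linarith

theorem UniformlyApproximable.maxPatternEntropy_eq_zero {r : ℕ}
    (hrep : IsRepresentation r K rep) (h : UniformlyApproximable rep K) :
    maxPatternEntropy K = 0 := by
  refine le_antisymm (ENNReal.le_of_forall_pos_le_add fun ε hε _ => ?_) bot_le
  have hε' : (0 : ℝ) < ε := hε
  rw [zero_add]
  obtain ⟨β, hβ⟩ := h.exists_condEntropy_le hrep (half_pos hε')
  refine limsup_le_of_le (by isBoundedDefault) ?_
  -- For such n the fixed cost H(β) is at most nε/2, and the n conditional entropies cost at most
  -- another nε/2.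
  filter_upwards [eventually_ge_atTop (⌈β.entropy / (ε / 2)⌉₊ + 1)] with n hn
  have hn1 : β.entropy / (ε / 2) ≤ n :=
    (Nat.le_ceil _).trans (by exact_mod_cast (Nat.le_succ _).trans hn)
  rw [div_le_iff₀ (half_pos hε')] at hn1
  refine ENNReal.div_le_of_le_mul (iSup_le fun a => ?_)
  rw [entropy_iJoin_eq fun i => (hrep (a i) (a i).2).1]
  have h1 := FinPart.entropy_iJoin_le (fun i => rep (a i)) β
  have h2 : ∑ i, (rep (a i)).condEntropy β ≤ n * (ε / 2) := by
    refine (Finset.sum_le_sum fun i _ => hβ (a i) (a i).2).trans ?_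
    simp
  calc _ ≤ ENNReal.ofReal (ε * n) := ENNReal.ofReal_le_ofReal (by linarith)
    _ = _ := by rw [ENNReal.ofReal_mul hε'.le, ENNReal.ofReal_natCast, ENNReal.ofReal_coe_nnreal]

theorem uniformlyApproximable_of_maxPatternEntropy_eq_zero {r : ℕ}
    (hrep : IsRepresentation r K rep) (h : maxPatternEntropy K = 0) :
    UniformlyApproximable rep K := by
  by_contra hn
  obtain ⟨η, hη, a, A, ha, hA, hfar⟩ := exists_seq_of_not_uniformlyApproximable hn
  -- Being η-far from all unions of atoms of the join forces mean variance, hence conditional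
  -- entropy, at least η/2 at each step of the chain rule.
  have hgrow : ∀ n : ℕ, n * (η / 2) ≤ (FinPart.iJoin fun i : Fin n => rep (a i)).entropy := by
    intro n
    induction n with
    | zero =>
      rw [Nat.cast_zero, zero_mul]
      exact Finset.sum_nonneg fun C _ =>
        Real.negMulLog_nonneg (measureReal_nonneg (μ := μ)) measureReal_le_one
    | succ n ih =>
      rw [FinPart.entropy_iJoin_succ]
      obtain ⟨S, hS, hAS⟩ := (FinPart.iJoin fun i : Fin n =>
        rep (a i)).exists_measureReal_symmDiff_le ((rep (a n)).measurableSet _ (hA n))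
      have h1 := hfar n S hS
      have h2 := (rep (a n)).meanVariance_le_condEntropy
        (FinPart.iJoin fun i : Fin n => rep (a i)) (hA n)
      simp only [Fin.val_castSucc, Fin.val_last]
      push_cast
      linarith
  have h1 : limsup (fun n : ℕ => patternEntropy K n / (n : ℝ≥0∞)) atTop < ENNReal.ofReal (η / 2) :=
    h.trans_lt (ENNReal.ofReal_pos.2 (half_pos hη))
  obtain ⟨n, hlt, hn⟩ := ((eventually_lt_of_limsup_lt h1).and (eventually_ge_atTop 1)).exists
  refine hlt.not_ge ?_
  rw [ENNReal.le_div_iff_mul_le (Or.inl (by positivity)) (Or.inl (ENNReal.natCast_ne_top n))]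
  calc ENNReal.ofReal (η / 2) * n = ENNReal.ofReal (n * (η / 2)) := by
        rw [mul_comm, ENNReal.ofReal_mul (Nat.cast_nonneg n), ENNReal.ofReal_natCast]
    _ ≤ ENNReal.ofReal (entropy (iJoin fun i : Fin n => a i)) := by
        refine ENNReal.ofReal_le_ofReal ?_
        rw [entropy_iJoin_eq fun i : Fin n => (hrep (a i) (ha i)).1]
        exact hgrow n
    _ ≤ patternEntropy K n :=
        le_iSup (fun b : Fin n → K => ENNReal.ofReal (entropy (iJoin fun i =>
          (b i : Partitions μ)))) fun i => ⟨a i, ha i⟩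

end Partitions

/-! ### Mean complexity -/

theorem FinPart.mem_biUnion_iff {X : Type*} [MeasurableSpace X] {μ : Measure X} (β : FinPart μ)
    {S : Finset (Set X)} (hS : S ⊆ β.atoms) {B : Set X} (hB : B ∈ β.atoms) {x : X} (hx : x ∈ B) :
    x ∈ (⋃ C ∈ S, C) ↔ B ∈ S := by
  refine ⟨fun h => ?_, fun h => Set.mem_iUnion₂.2 ⟨B, h, hx⟩⟩
  obtain ⟨C, hC, hxC⟩ := Set.mem_iUnion₂.1 h
  by_contra hne
  exact Set.disjoint_left.1 (β.disjoint B hB C (hS hC) fun e => hne (e ▸ hC)) hx hxC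

namespace Partitions

variable {X : Type*} [MeasurableSpace X] {μ : Measure X}
  {rep : Partitions μ → FinPart μ} {K : Set (Partitions μ)}

theorem measurableSet_hammingBall (rep : Partitions μ → FinPart μ) (E : Finset (Partitions μ))
    (x : X) (ε : ℝ) : MeasurableSet (hammingBall rep E x ε) := by
  classical
  have h1 : ∀ a, MeasurableSet {y | ¬ ∀ A ∈ (rep a).atoms, (x ∈ A ↔ y ∈ A)} := by
    intro a
    have h : {y | ¬ ∀ A ∈ (rep a).atoms, (x ∈ A ↔ y ∈ A)} =
        (⋂ A ∈ (rep a).atoms, {y | x ∈ A ↔ y ∈ A})ᶜ := by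
      ext y
      simp only [Set.mem_ofPred_eq, Set.mem_compl_iff, Set.mem_iInter]
    rw [h]
    refine MeasurableSet.compl ?_
    refine Finset.measurableSet_biInter _ fun A hA => ?_
    by_cases h : x ∈ A
    · simpa [h] using (rep a).measurableSet A hA
    · have h' : {y | x ∈ A ↔ y ∈ A} = Aᶜ := by
        ext y
        simp [h]
      rw [h']
      exact ((rep a).measurableSet A hA).compl
  refine measurableSet_lt (f := hamming rep E x) ?_ measurable_const
  change Measurable fun y => hamming rep E x y
  simp only [hamming, Finset.card_filter]
  refine Measurable.div_const ?_ _
  push_cast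
  exact Finset.measurable_fun_sum _ fun a _ =>
    Measurable.ite (h1 a) measurable_const measurable_const

theorem exists_of_hammingComplexity_le {E : Finset (Partitions μ)} {ε : ℝ} {C : ℕ}
    (h : hammingComplexity rep E ε ≤ C) :
    ∃ D : Finset X, D.card ≤ C ∧ 1 - ε < μ.real (⋃ x ∈ D, hammingBall rep E x ε) := by
  by_contra! hn
  have h1 : ((C + 1 : ℕ) : ℕ∞) ≤ hammingComplexity rep E ε := by
    refine le_iInf₂ fun D hD => ?_
    by_contra! hlt
    have : D.card < C + 1 := by exact_mod_cast hlt
    exact (hn D (Nat.le_of_lt_succ this)).not_gt hD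
  have h2 : C + 1 ≤ C := by exact_mod_cast h1.trans h
  omega

variable [IsProbabilityMeasure μ]

theorem UniformlyApproximable.boundedMeanComplexity {r : ℕ} (hrep : IsRepresentation r K rep)
    (h : UniformlyApproximable rep K) : BoundedMeanComplexity rep K := by
  classical
  intro ε hε
  -- The exceptional set `N a` of each partition then has measure at most rη < ε²/2, so Markov's
  -- inequality at level ε/2 leaves a bad set of measure below ε.
  obtain ⟨β, hβ⟩ := h (ε ^ 2 / (2 * (r + 1))) (by positivity)
  set η := ε ^ 2 / (2 * (r + 1)) with hη
  choose! S hS hAS using hβ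
  refine ⟨β.atoms.card, fun E hE hEK => ?_⟩
  have hE0 : (0 : ℝ) < E.card := by exact_mod_cast hE.card_pos
  set N : Partitions μ → Set X := fun a => ⋃ A ∈ (rep a).atoms, A ∆ (⋃ B ∈ S a A, B) with hN
  have hNm : ∀ a ∈ E, MeasurableSet (N a) := fun a ha =>
    Finset.measurableSet_biUnion _ fun A hA =>
      ((rep a).measurableSet A hA).symmDiff (β.measurableSet_biUnion (hS a (hEK ha) A hA))
  have hNμ : ∀ a ∈ E, μ.real (N a) ≤ r * η := by
    intro a ha
    refine (measureReal_biUnion_finset_le _ _).trans ?_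
    refine (Finset.sum_le_sum fun A hA => (hAS a (hEK ha) A hA).le).trans ?_
    rw [Finset.sum_const, nsmul_eq_mul]
    have : ((rep a).atoms.card : ℝ) ≤ r := by exact_mod_cast (hrep a (hEK ha)).2
    have : 0 < η := by positivity
    gcongr
  set c : ℝ := ε / 2 * E.card with hc
  set bad : Set X := {x | c ≤ ((E.filter fun a => x ∈ N a).card : ℝ)} with hbad
  have hbadμ : μ.real bad < ε := by
    have h1 := (mul_measureReal_le_sum (μ := μ) E hNm c).trans (Finset.sum_le_sum hNμ)
    rw [Finset.sum_const, nsmul_eq_mul, ← hbad] at h1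
    have h2 : ε / 2 * μ.real bad ≤ r * η := by
      refine le_of_mul_le_mul_left (le_trans (le_of_eq ?_) h1) hE0
      rw [hc]
      ring
    have h3 : (r + 1) * η = ε ^ 2 / 2 := by rw [hη]; field_simp
    have h4 : 0 < η := by positivity
    have h5 : ε / 2 * μ.real bad < ε / 2 * ε := by nlinarith
    exact lt_of_mul_lt_mul_left h5 (by positivity)
  have : Nonempty X := nonempty_of_isProbabilityMeasure μ
  -- One centre per atom of β, taken outside `bad` when possible; otherwise the choice is
  -- irrelevant, as no good point of B needs covering.
  have hpt : ∀ B : Set X, ∃ x : X, (B ∩ badᶜ).Nonempty → x ∈ B ∩ badᶜ := by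
    intro B
    by_cases hB : (B ∩ badᶜ).Nonempty
    · exact ⟨hB.some, fun h => h.some_mem⟩
    · exact ⟨Classical.arbitrary X, fun h => absurd h hB⟩
  choose p hp using hpt
  have hball : ∀ B ∈ β.atoms, ∀ y ∈ B, y ∉ bad → y ∈ hammingBall rep E (p B) ε := by
    intro B hB y hy hyb
    obtain ⟨hpB, hpb⟩ := hp B ⟨y, hy, hyb⟩
    have hyb' : ((E.filter fun a => y ∈ N a).card : ℝ) < c := not_le.1 hyb
    have hpb' : ((E.filter fun a => p B ∈ N a).card : ℝ) < c := not_le.1 hpb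
    rw [hammingBall, Set.mem_ofPred_eq, hamming, div_lt_iff₀ hE0]
    -- Off `N a`, the name with respect to a depends only on the atom of β. Two points of one atom
    -- can thus differ only where one of them lies in `N a`, and each does so for a proportion below
    -- ε/2.
    have hsub : (E.filter fun a => ¬ ∀ A ∈ (rep a).atoms, (p B ∈ A ↔ y ∈ A)) ⊆
        (E.filter fun a => p B ∈ N a) ∪ E.filter fun a => y ∈ N a := by
      intro a ha
      obtain ⟨haE, ha⟩ := Finset.mem_filter.1 ha
      by_contra hno
      simp only [Finset.mem_union, Finset.mem_filter, haE, true_and, not_or] at hno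
      refine ha fun A hA => ?_
      have h1 : ∀ z, z ∉ N a → (z ∈ A ↔ z ∈ ⋃ C ∈ S a A, C) := by
        intro z hz
        have : z ∉ A ∆ (⋃ C ∈ S a A, C) := fun h => hz (Set.mem_iUnion₂.2 ⟨A, hA, h⟩)
        rw [Set.mem_symmDiff] at this
        tauto
      rw [h1 _ hno.1, h1 _ hno.2, β.mem_biUnion_iff (hS a (hEK haE) A hA) hB hpB,
        β.mem_biUnion_iff (hS a (hEK haE) A hA) hB hy]
    have hcard : ((E.filter fun a => ¬ ∀ A ∈ (rep a).atoms, (p B ∈ A ↔ y ∈ A)).card : ℝ) ≤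
        (E.filter fun a => p B ∈ N a).card + (E.filter fun a => y ∈ N a).card := by
      exact_mod_cast (Finset.card_le_card hsub).trans (Finset.card_union_le _ _)
    refine lt_of_le_of_lt (le_trans (le_of_eq ?_) hcard) (by linarith)
    congr!
  have hcov : 1 - ε < μ.real (⋃ x ∈ β.atoms.image p, hammingBall rep E x ε) := by
    have h1 : (Set.univ : Set X) ≤ᵐ[μ]
        (bad ∪ ⋃ x ∈ β.atoms.image p, hammingBall rep E x ε : Set X) := by
      filter_upwards [β.cover] with y hy _
      obtain ⟨B, hB, hyB⟩ := hy
      by_cases hyb : y ∈ bad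
      · exact Or.inl hyb
      · exact Or.inr (Set.mem_iUnion₂.2
          ⟨p B, Finset.mem_image_of_mem p hB, hball B hB y hyB hyb⟩)
    have h2 : μ.real Set.univ ≤
        μ.real (bad ∪ ⋃ x ∈ β.atoms.image p, hammingBall rep E x ε) :=
      ENNReal.toReal_mono (measure_ne_top μ _) (measure_mono_ae h1)
    have h3 := measureReal_union_le (μ := μ) bad (⋃ x ∈ β.atoms.image p, hammingBall rep E x ε)
    rw [probReal_univ] at h2
    linarith
  refine (iInf₂_le (β.atoms.image p) hcov).trans ?_
  exact_mod_cast Finset.card_image_le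

theorem uniformlyApproximable_of_boundedMeanComplexity (h : BoundedMeanComplexity rep K) :
    UniformlyApproximable rep K := by
  classical
  by_contra hn
  obtain ⟨η, hη, a, A, ha, hinj, hA, hsep⟩ := exists_separated_seq hn
  set ε := η / 8 with hε
  have hε0 : 0 < ε := by positivity
  obtain ⟨C, hC⟩ := h ε hε0
  -- C does not depend on `E`, so n may be chosen after it: half of n indices already exceed the 2 ^
  -- C possible traces on the centres.
  set n := 2 * 2 ^ C + 2 with hn
  have hn0 : (0 : ℝ) < n := by positivity
  set E : Finset (Partitions μ) := (Finset.range n).image a with hE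
  have hEcard : E.card = n := by
    rw [hE, Finset.card_image_of_injective _ hinj, Finset.card_range]
  obtain ⟨D, hDC, hDμ⟩ := exists_of_hammingComplexity_le (hC E
    ⟨a 0, Finset.mem_image_of_mem a (Finset.mem_range.2 (by omega))⟩ (by
      intro b hb
      obtain ⟨i, -, rfl⟩ := Finset.mem_image.1 hb
      exact ha i))
  have : Nonempty X := nonempty_of_isProbabilityMeasure μ
  obtain ⟨c, hc, hcD⟩ := exists_measurable_selection D (fun x => hammingBall rep E x ε)
    fun x => measurableSet_hammingBall rep E x ε
  set U := ⋃ x ∈ D, hammingBall rep E x ε with hU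
  have hUm : MeasurableSet U :=
    D.measurableSet_biUnion fun x _ => measurableSet_hammingBall rep E x ε
  have hUc : μ.real Uᶜ ≤ ε := by
    rw [probReal_compl_eq_one_sub hUm]
    linarith
  have hAm : ∀ i, MeasurableSet (A i) := fun i => (rep (a i)).measurableSet _ (hA i)
  -- `W i` replaces each point by its selected centre `c x` before testing membership in `A i`; it
  -- is determined by the trace of `A i` on `D`.
  set W : ℕ → Set X := fun i => c ⁻¹' (A i ∩ D) with hW
  -- For x in `U`, each i with x in `A i ∆ W i` gives a partition separating x from `c x`, and there
  -- are fewer than εn of these. Injectivity of `a` makes indices and partitions correspond.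
  have hsum : ∑ i ∈ Finset.range n, μ.real (A i ∆ W i ∩ U) ≤ ε * n := by
    refine sum_measureReal_le_of_card_le _
      (fun i _ => ((hAm i).symmDiff (hc _)).inter hUm) fun x => ?_
    by_cases hx : x ∈ U
    · obtain ⟨hcx, hb⟩ := hcD x hx
      rw [hammingBall, Set.mem_ofPred_eq, hamming, hEcard, div_lt_iff₀ hn0] at hb
      refine le_trans ?_ hb.le
      refine Nat.cast_le.2 (Finset.card_le_card_of_injOn a (fun i hi => ?_) hinj.injOn)
      rw [Finset.mem_coe, Finset.mem_filter] at hi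
      obtain ⟨hin, hi, -⟩ := hi
      refine Finset.mem_coe.2 (Finset.mem_filter.2 ⟨Finset.mem_image_of_mem a hin, fun hall => ?_⟩)
      have h1 := hall (A i) (hA i)
      have h2 : x ∈ W i ↔ c x ∈ A i := ⟨fun h => h.1, fun h => ⟨h, hcx⟩⟩
      rw [Set.mem_symmDiff, h2] at hi
      tauto
    · simp only [Set.mem_inter_iff, hx, and_false, Finset.filter_false, Finset.card_empty,
        Nat.cast_zero]
      positivity
  have hsum' : ∑ i ∈ Finset.range n, μ.real (A i ∆ W i) ≤ 2 * ε * n := by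
    have h1 : ∀ i ∈ Finset.range n, μ.real (A i ∆ W i) ≤ μ.real (A i ∆ W i ∩ U) + ε := by
      intro i _
      have h2 : A i ∆ W i ⊆ (A i ∆ W i ∩ U) ∪ Uᶜ := fun x hx => by
        by_cases hxU : x ∈ U
        · exact Or.inl ⟨hx, hxU⟩
        · exact Or.inr hxU
      have h3 := (measureReal_mono (μ := μ) h2).trans (measureReal_union_le _ _)
      linarith
    refine (Finset.sum_le_sum h1).trans ?_
    rw [Finset.sum_add_distrib, Finset.sum_const, Finset.card_range, nsmul_eq_mul]
    linarith
  -- The mean of μ(Aᵢ ∆ Wᵢ) is at most 2ε, so at least half of the indices are below 4ε = η/2; two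
  -- of them with equal `W` contradict η-separation.
  set good := (Finset.range n).filter fun i => μ.real (A i ∆ W i) < 4 * ε with hgood
  have hgoodcard : 2 ^ C < good.card := by
    set bad := (Finset.range n).filter fun i => ¬ μ.real (A i ∆ W i) < 4 * ε with hbad
    have h1 : good.card + bad.card = n := by
      rw [hgood, hbad, Finset.card_filter_add_card_filter_not, Finset.card_range]
    have h2 : (bad.card : ℝ) * (4 * ε) ≤ 2 * ε * n := by
      refine le_trans ?_ hsum'
      rw [← nsmul_eq_mul]
      refine (Finset.card_nsmul_le_sum bad _ _ fun i hi =>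
        not_lt.1 (Finset.mem_filter.1 hi).2).trans ?_
      exact Finset.sum_le_sum_of_subset_of_nonneg (Finset.filter_subset _ _)
        fun _ _ _ => measureReal_nonneg
    have h3 : (2 * bad.card : ℝ) ≤ n := by
      refine le_of_mul_le_mul_right ?_ (by positivity : 0 < 2 * ε)
      linarith
    have h4 : 2 * bad.card ≤ n := by exact_mod_cast h3
    omega
  obtain ⟨i, hi, j, hj, hij, hD⟩ := Finset.exists_ne_map_eq_of_card_lt_of_maps_to
    (s := good) (t := D.powerset) (f := fun i => D.filter fun x => x ∈ A i)
    (by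
      rw [Finset.card_powerset]
      exact (Nat.pow_le_pow_right (by norm_num) hDC).trans_lt hgoodcard)
    fun i _ => Finset.mem_coe.2 (Finset.mem_powerset.2 (Finset.filter_subset _ _))
  have hWij : W i = W j := by
    have h1 : ∀ x, x ∈ D → (x ∈ A i ↔ x ∈ A j) := by
      intro x hx
      simpa [hx] using Finset.ext_iff.1 hD x
    ext x
    simp only [hW, Set.mem_preimage, Set.mem_inter_iff, Finset.mem_coe]
    exact and_congr_left fun hx => h1 _ hx
  have h1 := (Finset.mem_filter.1 hi).2
  have h2 := (Finset.mem_filter.1 hj).2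
  rw [hWij] at h1
  rw [symmDiff_comm] at h2
  have h3 := measureReal_symmDiff_le (μ := μ) (s := A i) (t := W j) (A j)
    (measure_ne_top μ _) (measure_ne_top μ _)
  linarith [hsep i j hij]

end Partitions

end LowComplexity

theorem theorem1p1 {X : Type*} [MeasurableSpace X] (μ : Measure X) [IsProbabilityMeasure μ]
    (r : ℕ) (hr : 2 ≤ r) (K : Set (LowComplexity.Partitions μ))
    (hK : K ⊆ LowComplexity.Partitions.atMost μ r)
    (rep : LowComplexity.Partitions μ → LowComplexity.FinPart μ)
    (hrep : LowComplexity.Partitions.IsRepresentation r K rep) :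
    List.TFAE [
      LowComplexity.Partitions.RokhlinPrecompact r K,
      LowComplexity.Partitions.maxPatternEntropy K = 0,
      TotallyBounded (LowComplexity.Partitions.atomIndicators rep K),
      LowComplexity.Partitions.BoundedMeanComplexity rep K] := by
  open LowComplexity.Partitions in
  have h1 : RokhlinPrecompact r K ↔ UniformlyApproximable rep K :=
    ⟨uniformlyApproximable_of_rokhlinPrecompact hrep, fun h => h.rokhlinPrecompact hK hrep⟩
  have h2 : maxPatternEntropy K = 0 ↔ UniformlyApproximable rep K :=
    ⟨uniformlyApproximable_of_maxPatternEntropy_eq_zero hrep,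
      fun h => h.maxPatternEntropy_eq_zero hrep⟩
  have h3 : TotallyBounded (atomIndicators rep K) ↔ UniformlyApproximable rep K :=
    ⟨uniformlyApproximable_of_totallyBounded, fun h => h.totallyBounded⟩
  have h4 : BoundedMeanComplexity rep K ↔ UniformlyApproximable rep K :=
    ⟨uniformlyApproximable_of_boundedMeanComplexity, fun h => h.boundedMeanComplexity hrep⟩
  rw [h1, h2, h3, h4]
  tfae_finish
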